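/- Let $n\ge 1$ and $\Omega_n=\{0,1,-1,2,-2,\ldots,n,-n\}$. A signed permutation of length $n$ is a bijection $\pi:\Omega_n\to\Omega_n$ with $\pi(-a)=-\pi(a)$ for all $a\in\Omega_n$; write $\pi_i=\pi(i)$ for $0\le i\le n$ (so $\pi_0=0$), and let $\pi^{-1}$ be the inverse bijection. The $r$-order on $\mathbb{Z}$ is the total order $-1<_r-2<_r\cdots<_r0<_r1<_r2<_r\cdots$. For integers $i,j$ let $\underline{b}_{n,i,j}$ be the number of signed permutations $\pi$ of length $n$ such that exactly $i$ indices $k\in\{0,1,\ldots,n-1\}$ satisfy $\pi_k>_r\pi_{k+1}$ (descents) and exactly $j$ indices $k\in\{0,1,\ldots,n-1\}$ satisfy $\pi^{-1}_k>_r\pi^{-1}_{k+1}$ (inverse descents). Then for all $n\ge 2$ and $0\le i,j\le n$, $$ \begin{aligned} n\,\underline{b}_{n,i,j} ={}&(n+i+j+2ij)\,\underline{b}_{n-1,i,j}\\ &+\bigl((2n-1)i-(2i+1)(j-1)\bigr)\,\underline{b}_{n-1,i,j-1}\\ &+\bigl((2n-1)j-(2j+1)(i-1)\bigr)\,\underline{b}_{n-1,i-1,j}\\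 &+\bigl((2n^2-n)+2(i-1)(j-1)+(1-2n)(i+j-2)\bigr)\,\underline{b}_{n-1,i-1,j-1}, \end{aligned} $$ where $\underline{b}_{1,0,0}=\underline{b}_{1,1,1}=1$, $\underline{b}_{1,0,1}=\underline{b}_{1,1,0}=0$, and $\underline{b}_{n,i,j}=0$ for all $n\ge 1$ if $i<0$ or $j<0$. -/

import Mathlib

namespace TypeB

/-- The set `Ω_n = {0, 1, -1, 2, -2, …, n, -n}`. -/
abbrev Omega (n : ℕ) : Type := ↥(Finset.Icc (-(n : ℤ)) (n : ℤ))

/-- The hyperoctahedral group `𝔅_n` of signed permutations of length `n`: the bijections `π` of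
`Ω_n` such that `π a = b` implies `π (-a) = -b`. In the formula below `a'` is the element `-a`. -/
def SignedPerm (n : ℕ) : Subgroup (Equiv.Perm (Omega n)) where
  carrier := {π | ∀ a a' : Omega n, (a' : ℤ) = -(a : ℤ) → (π a' : ℤ) = -(π a : ℤ)}
  one_mem' := fun _ _ h => h
  mul_mem' := fun {σ τ} hσ hτ a a' h => hσ (τ a) (τ a') (hτ a a' h)
  inv_mem' := by
    intro π hπ a a' h
    have hmem : -((π⁻¹ a : Omega n) : ℤ) ∈ Finset.Icc (-(n : ℤ)) (n : ℤ) := by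
      have := Finset.mem_Icc.1 (π⁻¹ a).2
      rw [Finset.mem_Icc]
      omega
    have h1 := hπ (π⁻¹ a) ⟨_, hmem⟩ rfl
    rw [show π (π⁻¹ a) = a from π.apply_symm_apply a, ← h] at h1
    have h2 : π⁻¹ a' = ⟨_, hmem⟩ := by
      rw [Equiv.Perm.inv_eq_iff_eq]
      exact (Subtype.ext h1).symm
    rw [h2]

/-- The strict `r`-order `-1 <_r -2 <_r ⋯ <_r 0 <_r 1 <_r 2 <_r ⋯` on `ℤ`: every negative integer
precedes every nonnegative one, the negative integers are ordered by increasing absolute value,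
and the nonnegative integers are ordered as usual. -/
def rLT (a b : ℤ) : Prop :=
  (a < 0 ∧ 0 ≤ b) ∨ (a < 0 ∧ b < 0 ∧ b < a) ∨ (0 ≤ a ∧ 0 ≤ b ∧ a < b)

instance (a b : ℤ) : Decidable (rLT a b) := by
  unfold rLT
  infer_instance

/-- The integer `π_i = π(i)` for `0 ≤ i ≤ n`. -/
def entry {n : ℕ} (π : SignedPerm n) (i : Fin (n + 1)) : ℤ :=
  (π.1 ⟨(i : ℤ), Finset.mem_Icc.2 ⟨by omega, by omega⟩⟩ : ℤ)

/-- The set of indices `i ∈ [0, n - 1]` with `π_i >_r π_{i+1}`. -/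
def DesSet {n : ℕ} (π : SignedPerm n) : Finset (Fin n) :=
  {i : Fin n | rLT (entry π i.succ) (entry π i.castSucc)}

/-- The number of descents of `π` under the `r`-order. -/
def des {n : ℕ} (π : SignedPerm n) : ℕ := (DesSet π).card

/-- The set of indices `i ∈ [0, n - 1]` with `π⁻¹_i >_r π⁻¹_{i+1}`. -/
def iDesSet {n : ℕ} (π : SignedPerm n) : Finset (Fin n) :=
  {i : Fin n | rLT (entry π⁻¹ i.succ) (entry π⁻¹ i.castSucc)}

/-- The number of inverse descents of `π` under the `r`-order. -/
def ides {n : ℕ} (π : SignedPerm n) : ℕ := (iDesSet π).card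

/-- The set of signed permutations of length `n` with `i` descents and `j` inverse descents under
the `r`-order. -/
def B (n : ℕ) (i j : ℤ) : Set (SignedPerm n) :=
  {π | (des π : ℤ) = i ∧ (ides π : ℤ) = j}

/-- The number of signed permutations of length `n` with `i` descents and `j` inverse descents
under the `r`-order. -/
noncomputable def b (n : ℕ) (i j : ℤ) : ℕ := (B n i j).ncard

end TypeB

/-! The heart is the two-variable identity `sum_signedPerm`: ∑_π C(k+n-des π, n) C(l+n-ides π, n) =
C(2kl+k+l+n, n) for all naturals k, l.

By `card_compat`, the first factor counts the sequences f with values in {0, …, k} that increase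
weakly along π, strictly at descents (P-partitions); the second does the same for π⁻¹. A signed
permutation with one sequence of each kind is encoded, by stable sorting, as a weakly increasing
sequence of n cells (f, sign, g) (`compatEquiv`). The cells form a chain of (k+1)(l+1) + kl =
2kl+k+l+1 elements, whence the right-hand side.

Put N = 2kl+k+l. The relation (m+1) C(N+m+1, m+1) = (N+m+1) C(N+m, m) links the identities for
lengths m+1 and m. Rewriting the right-hand side in the products of binomials for length m+1 gives
exactly the four coefficients of the recurrence (`sum_recRHS`). These products, as functions of k
and l, are linearly independent (`eq_zero_of_sum_sum_choose_eq_zero`), so coefficients can be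
compared. -/

namespace TypeB

/-! ### Counting sequences with prescribed minimal gaps -/

/-- The sequences of natural numbers, bounded by `k`, that start at `d 0` or above and whose
`j`-th increment is at least `d j`. -/
def gapSeqs (n k : ℕ) (d : Fin n → ℕ) : Set (Fin n → ℕ) :=
  {f | (∀ i : Fin n, (i : ℕ) = 0 → d i ≤ f i) ∧ (∀ i j : Fin n, (j : ℕ) = i + 1 → f i + d j ≤ f j) ∧
    ∀ i, f i ≤ k}

theorem gapSeqs_finite (n k : ℕ) (d : Fin n → ℕ) : (gapSeqs n k d).Finite :=
  (Set.finite_Iic (fun _ : Fin n => k)).subset fun _ hf => hf.2.2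

instance (n k : ℕ) (d : Fin n → ℕ) : Finite (gapSeqs n k d) := gapSeqs_finite n k d

/-- Of all the gaps after `i` only the last one is kept: this is what bounds the remaining sequence
once the last term is removed. -/
theorem gapSeqs_bound {n k : ℕ} {d f : Fin (n + 1) → ℕ} (hf : f ∈ gapSeqs (n + 1) k d)
    (i : Fin (n + 1)) : f i + (if i = Fin.last n then 0 else d (Fin.last n)) ≤ f (Fin.last n) := by
  induction i using Fin.reverseInduction with
  | last => simp
  | cast i ih =>
    have h := hf.2.1 i.castSucc i.succ (by simp)
    have hne : i.castSucc ≠ Fin.last n := (Fin.castSucc_lt_last i).ne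
    rw [if_neg hne]
    by_cases hs : i.succ = Fin.last n
    · rw [hs] at h; exact h
    · rw [if_neg hs] at ih; omega

theorem snoc_mem_gapSeqs {n k y : ℕ} {d : Fin (n + 1) → ℕ} {f : Fin n → ℕ}
    (hf : f ∈ gapSeqs n y (Fin.init d)) (hk : y + d (Fin.last n) ≤ k) :
    (Fin.snoc f (y + d (Fin.last n)) : Fin (n + 1) → ℕ) ∈ gapSeqs (n + 1) k d := by
  refine ⟨fun i => ?_, fun i j => ?_, fun i => ?_⟩
  · induction i using Fin.lastCases with
    | last => intro _; simp
    | cast i => intro h; simpa [Fin.init] using hf.1 i (by simpa using h)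
  · induction j using Fin.lastCases with
    | last =>
      induction i using Fin.lastCases with
      | last => intro h; simp at h
      | cast i => intro _; simpa using hf.2.2 i
    | cast j =>
      induction i using Fin.lastCases with
      | last => intro h; simp at h; omega
      | cast i => intro h; simpa [Fin.init] using hf.2.1 i j (by simpa using h)
  · induction i using Fin.lastCases with
    | last => simpa using hk
    | cast i => simpa using (hf.2.2 i).trans (by omega)

theorem init_mem_gapSeqs {n k : ℕ} {d f : Fin (n + 1) → ℕ} (hf : f ∈ gapSeqs (n + 1) k d) :
    Fin.init f ∈ gapSeqs n (f (Fin.last n) - d (Fin.last n)) (Fin.init d) := by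
  refine ⟨fun i h => hf.1 i.castSucc (by simpa using h),
    fun i j h => hf.2.1 i.castSucc j.castSucc (by simpa using h), fun i => ?_⟩
  have h := gapSeqs_bound hf i.castSucc
  rw [if_neg (Fin.castSucc_lt_last i).ne] at h
  simp only [Fin.init]
  omega

theorem le_last_of_mem_gapSeqs {n k : ℕ} {d f : Fin (n + 1) → ℕ} (hf : f ∈ gapSeqs (n + 1) k d) :
    d (Fin.last n) ≤ f (Fin.last n) := by
  rcases n with _ | n
  · exact hf.1 _ (by simp)
  · have h := gapSeqs_bound hf 0
    rw [if_neg (by simp [Fin.ext_iff])] at h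
    omega

/-- Splitting off the last term of a sequence. -/
def gapSeqsSuccEquiv (n k : ℕ) (d : Fin (n + 1) → ℕ) :
    gapSeqs (n + 1) k d ≃
      Σ y : Fin (k + 1 - d (Fin.last n)), gapSeqs n y (Fin.init d) where
  toFun f := ⟨⟨f.1 (Fin.last n) - d (Fin.last n), by
      have := f.2.2.2 (Fin.last n); have := le_last_of_mem_gapSeqs f.2; omega⟩,
    ⟨Fin.init f.1, init_mem_gapSeqs f.2⟩⟩
  invFun p := ⟨Fin.snoc p.2.1 (p.1 + d (Fin.last n)), snoc_mem_gapSeqs p.2.2 (by omega)⟩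
  left_inv f := by
    have := le_last_of_mem_gapSeqs f.2
    apply Subtype.ext
    simp only [Nat.sub_add_cancel this]
    exact Fin.snoc_init_self f.1
  right_inv p := by
    obtain ⟨y, f, hf⟩ := p
    refine Sigma.ext (Fin.ext (by simp)) ?_
    dsimp only
    congr! 1 <;> simp

/-- Subtracting the partial sums of `d` would leave weakly increasing sequences bounded by `k - ∑
d`. The induction instead sums over the last term. Truncated subtraction is harmless, since the
binomial vanishes when `∑ d > k`. -/
theorem card_gapSeqs (n k : ℕ) (d : Fin n → ℕ) :
    Nat.card (gapSeqs n k d) = (k + n - ∑ i, d i).choose n := by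
  induction n generalizing k with
  | zero =>
    have : gapSeqs 0 k d = Set.univ := by
      ext f; simp [gapSeqs]
    rw [this]; simp
  | succ n ih =>
    rw [Nat.card_congr (gapSeqsSuccEquiv n k d), Nat.card_sigma]
    simp only [ih]
    rw [Fin.sum_univ_castSucc, Fin.sum_univ_eq_sum_range (fun y => (y + n - _).choose n)]
    simp only [Fin.init]
    set s := ∑ i : Fin n, d i.castSucc
    set e := d (Fin.last n)
    -- The hockey-stick identity, shifted by `s`.
    have key : ∀ m, ∑ y ∈ Finset.range m, (y + n - s).choose n = (m + n - s).choose (n + 1) := by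
      intro m
      induction m with
      | zero => simp; exact (Nat.choose_eq_zero_of_lt (by omega)).symm
      | succ m ihm =>
        rw [Finset.sum_range_succ, ihm]
        by_cases h : s ≤ m + n
        · rw [show m + 1 + n - s = (m + n - s) + 1 by omega, Nat.choose_succ_succ, add_comm]
        -- Here subtraction truncates: for `n = 0` the sum `s` is empty, a contradiction; otherwise
        -- all three binomials are zero.
        · rcases n with _ | n
          · simp [s] at h
          · rw [Nat.choose_eq_zero_of_lt (by omega), Nat.choose_eq_zero_of_lt (by omega),
              Nat.choose_eq_zero_of_lt (by omega)]
    rw [key]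
    by_cases h : e ≤ k + 1
    · congr 1; omega
    · rw [Nat.choose_eq_zero_of_lt (by omega), Nat.choose_eq_zero_of_lt (by omega)]

theorem card_fin_gapSeqs (n k : ℕ) (d : Fin n → ℕ) :
    Nat.card {f : Fin n → Fin (k + 1) // (∀ i : Fin n, (i : ℕ) = 0 → d i ≤ f i) ∧
      ∀ i j : Fin n, (j : ℕ) = i + 1 → (f i : ℕ) + d j ≤ f j} = (k + n - ∑ i, d i).choose n := by
  rw [← card_gapSeqs]
  exact Nat.card_congr
    { toFun := fun f => ⟨fun i => f.1 i, f.2.1, f.2.2, fun i => Nat.le_of_lt_succ (f.1 i).2⟩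
      invFun := fun f => ⟨fun i => ⟨f.1 i, by have := f.2.2.2 i; omega⟩, f.2.1, f.2.2.1⟩
      left_inv := fun _ => rfl
      right_inv := fun _ => rfl }

theorem monotone_fin_iff {α : Type*} [Preorder α] {n : ℕ} {f : Fin n → α} :
    Monotone f ↔ ∀ i j : Fin n, (j : ℕ) = i + 1 → f i ≤ f j := by
  refine ⟨fun h i j hij => h (Fin.le_def.2 (by omega)), fun h => ?_⟩
  rcases n with _ | n
  · intro i; exact i.elim0
  · exact Fin.monotone_iff_le_succ.2 fun i => h _ _ (by simp)

theorem strictMono_fin_iff {α : Type*} [Preorder α] {n : ℕ} {f : Fin n → α} :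
    StrictMono f ↔ ∀ i j : Fin n, (j : ℕ) = i + 1 → f i < f j := by
  refine ⟨fun h i j hij => h (Fin.lt_def.2 (by omega)), fun h => ?_⟩
  rcases n with _ | n
  · intro i; exact i.elim0
  · exact Fin.strictMono_iff_lt_succ.2 fun i => h _ _ (by simp)

theorem card_monotone {α : Type*} [LinearOrder α] [Fintype α] (n k : ℕ)
    (hα : Fintype.card α = k + 1) :
    Nat.card {f : Fin n → α // Monotone f} = (k + n).choose n := by
  have h := card_fin_gapSeqs n k (fun _ => 0)
  simp only [Finset.sum_const_zero, Nat.sub_zero] at h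
  rw [← h]
  let e := Fintype.orderIsoFinOfCardEq α hα
  refine Nat.card_congr ((Equiv.arrowCongr (Equiv.refl _) e.symm.toEquiv).subtypeEquiv fun f => ?_)
  rw [monotone_fin_iff]
  simp


/-! ### Signed permutations as permutations with sign vectors -/

/-- The integer `i + 1` with sign `e`, where `true` stands for a positive sign. -/
def signed {n : ℕ} (e : Bool) (i : Fin n) : ℤ := if e then (i : ℤ) + 1 else -((i : ℤ) + 1)

theorem signed_inj {n : ℕ} {e e' : Bool} {i i' : Fin n} (h : signed e i = signed e' i') :
    e = e' ∧ i = i' := by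
  rw [Fin.ext_iff]
  cases e <;> cases e' <;> simp [signed] at h ⊢ <;> omega

/-- The `r`-order lists negatives by increasing absolute value, so it is lexicographic in (sign,
absolute value) without any reversal. -/
theorem rLT_signed {n : ℕ} (e e' : Bool) (i i' : Fin n) :
    rLT (signed e i) (signed e' i') ↔ toLex (e, i) < toLex (e', i') := by
  rw [Prod.Lex.toLex_lt_toLex, Fin.lt_def]
  cases e <;> cases e' <;> simp [signed, rLT, -Fin.val_fin_lt, Bool.lt_iff] <;> omega

theorem signed_mem {n : ℕ} (e : Bool) (i : Fin n) :
    signed e i ∈ Finset.Icc (-(n : ℤ)) (n : ℤ) := by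
  rw [Finset.mem_Icc]
  cases e <;> simp [signed] <;> omega

/-- Every element of `Ω_n` is zero or a signed positive integer. -/
theorem eq_zero_or_eq_signed {n : ℕ} {x : ℤ} (hx : x ∈ Finset.Icc (-(n : ℤ)) (n : ℤ)) :
    x = 0 ∨ ∃ (e : Bool) (i : Fin n), x = signed e i := by
  rw [Finset.mem_Icc] at hx
  rcases lt_trichotomy x 0 with h | h | h
  · exact Or.inr ⟨false, ⟨x.natAbs - 1, by omega⟩, by simp [signed]; omega⟩
  · exact Or.inl h
  · exact Or.inr ⟨true, ⟨x.natAbs - 1, by omega⟩, by simp [signed]; omega⟩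

theorem signed_ne_zero {n : ℕ} (e : Bool) (i : Fin n) : signed e i ≠ 0 := by
  cases e <;> simp [signed] <;> omega

theorem signed_not {n : ℕ} (e : Bool) (i : Fin n) : signed (!e) i = -signed e i := by
  cases e <;> simp [signed]

/-- The odd map of `Ω_n` that sends `i + 1` to `signed (ε i) (σ i)`. -/
def act {n : ℕ} (σ : Fin n → Fin n) (ε : Fin n → Bool) (x : Omega n) : Omega n :=
  if h : (x : ℤ) = 0 then x else
    let i : Fin n := ⟨(x : ℤ).natAbs - 1, by have := Finset.mem_Icc.1 x.2; omega⟩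
    ⟨signed (decide (0 < (x : ℤ)) == ε i) (σ i), signed_mem _ _⟩

theorem act_zero {n : ℕ} (σ : Fin n → Fin n) (ε : Fin n → Bool) {x : Omega n} (hx : (x : ℤ) = 0) :
    act σ ε x = x := by
  simp [act, hx]

theorem act_signed {n : ℕ} (σ : Fin n → Fin n) (ε : Fin n → Bool) {x : Omega n} {e : Bool}
    {i : Fin n} (hx : (x : ℤ) = signed e i) : (act σ ε x : ℤ) = signed (e == ε i) (σ i) := by
  have h0 : (x : ℤ) ≠ 0 := hx ▸ signed_ne_zero e i
  have hi : (⟨(x : ℤ).natAbs - 1, by have := Finset.mem_Icc.1 x.2; omega⟩ : Fin n) = i := by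
    apply Fin.ext
    dsimp only
    generalize (x : ℤ) = y at hx
    subst hx
    cases e <;> simp [signed] <;> omega
  have he : decide (0 < (x : ℤ)) = e := by
    rw [hx]
    cases e <;> simp [signed]
  unfold act
  rw [dif_neg h0]
  simp only [hi, he]

theorem act_act {n : ℕ} (σ : Equiv.Perm (Fin n)) (ε : Fin n → Bool) (x : Omega n) :
    act ⇑σ⁻¹ (ε ∘ ⇑σ⁻¹) (act σ ε x) = x := by
  rcases eq_zero_or_eq_signed x.2 with h | ⟨e, i, h⟩
  · rw [act_zero σ ε h, act_zero _ _ h]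
  · apply Subtype.ext
    rw [act_signed _ _ (act_signed σ ε h), h]
    rw [Function.comp_apply, show σ⁻¹ (σ i) = i from σ.symm_apply_apply i]
    cases e <;> cases ε i <;> rfl

/-- The signed permutation with absolute values `σ` and signs `ε`. -/
def ofPair {n : ℕ} (p : Equiv.Perm (Fin n) × (Fin n → Bool)) : SignedPerm n where
  val :=
    { toFun := act p.1 p.2
      invFun := act ⇑p.1⁻¹ (p.2 ∘ ⇑p.1⁻¹)
      left_inv := act_act p.1 p.2
      right_inv := fun x => by
        have h := act_act p.1⁻¹ (p.2 ∘ ⇑p.1⁻¹) x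
        rwa [inv_inv, Function.comp_assoc, ← Equiv.Perm.coe_mul, inv_mul_cancel,
          Equiv.Perm.coe_one, Function.comp_id] at h }
  property := by
    intro a a' h
    change (act p.1 p.2 a' : ℤ) = -(act p.1 p.2 a : ℤ)
    rcases eq_zero_or_eq_signed a.2 with h0 | ⟨e, i, h0⟩
    · rw [act_zero _ _ h0, act_zero _ _ (by rw [h, h0, neg_zero]), h]
    · rw [act_signed _ _ h0, act_signed _ _ (e := !e) (i := i) (by rw [h, h0, signed_not]),
        ← signed_not]
      cases e <;> cases p.2 i <;> rfl

theorem inv_ofPair {n : ℕ} (p : Equiv.Perm (Fin n) × (Fin n → Bool)) :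
    (ofPair p)⁻¹ = ofPair (p.1⁻¹, p.2 ∘ ⇑p.1⁻¹) := by
  apply Subtype.ext
  apply Equiv.ext
  intro x
  rfl

theorem entry_zero_ofPair {n : ℕ} (p : Equiv.Perm (Fin n) × (Fin n → Bool)) :
    entry (ofPair p) 0 = 0 :=
  congrArg Subtype.val (act_zero (x := ⟨((0 : Fin (n + 1)) : ℕ), _⟩) p.1 p.2 (by simp))

theorem entry_succ_ofPair {n : ℕ} (p : Equiv.Perm (Fin n) × (Fin n → Bool)) (i : Fin n) :
    entry (ofPair p) i.succ = signed (p.2 i) (p.1 i) := by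
  have h := act_signed (x := ⟨((i.succ : Fin (n + 1)) : ℕ), Finset.mem_Icc.2
    ⟨by omega, by have := i.2; simp⟩⟩) (e := true) (i := i) p.1 p.2 (by simp [signed])
  rw [Bool.true_beq] at h
  exact h

theorem apply_eq_zero {n : ℕ} (π : SignedPerm n) {x : Omega n} (hx : (x : ℤ) = 0) :
    (π.1 x : ℤ) = 0 := by
  have := π.2 x x (by rw [hx, neg_zero])
  omega

theorem exists_apply_signed {n : ℕ} (π : SignedPerm n) (e : Bool) (i : Fin n) :
    ∃ (e' : Bool) (j : Fin n), (π.1 ⟨signed e i, signed_mem e i⟩ : ℤ) = signed e' j := by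
  refine (eq_zero_or_eq_signed (π.1 ⟨signed e i, signed_mem e i⟩).2).resolve_left fun h => ?_
  have h1 := apply_eq_zero π⁻¹ h
  rw [show (π⁻¹).1 (π.1 ⟨signed e i, signed_mem e i⟩) = ⟨signed e i, signed_mem e i⟩ from
    π.1.symm_apply_apply _] at h1
  exact signed_ne_zero e i h1

theorem ofPair_bijective (n : ℕ) : Function.Bijective (ofPair (n := n)) := by
  constructor
  · intro p q h
    have h1 : ∀ i, p.2 i = q.2 i ∧ p.1 i = q.1 i := fun i => signed_inj (by
      rw [← entry_succ_ofPair, h, entry_succ_ofPair])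
    exact Prod.ext (Equiv.ext fun i => (h1 i).2) (funext fun i => (h1 i).1)
  · intro π
    choose ε σ h using exists_apply_signed π true
    have hodd : ∀ e i, (π.1 ⟨signed e i, signed_mem e i⟩ : ℤ) = signed (e == ε i) (σ i) := by
      intro e i
      cases e
      · rw [π.2 ⟨signed true i, signed_mem true i⟩ ⟨signed false i, signed_mem false i⟩
          (signed_not true i), h, ← signed_not]
        cases ε i <;> rfl
      · rw [h, Bool.true_beq]
    have hinj : Function.Injective σ := by
      intro i j hij
      -- Feeding in the sign `ε i` makes the image positive, so equal absolute values give equal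
      -- images.
      have h1 := hodd (ε i) i
      have h2 := hodd (ε j) j
      rw [beq_self_eq_true] at h1 h2
      rw [hij, ← h2] at h1
      exact (signed_inj (congrArg Subtype.val (π.1.injective (Subtype.ext h1)))).2
    refine ⟨(Equiv.ofBijective σ (Finite.injective_iff_bijective.1 hinj), ε), ?_⟩
    apply Subtype.ext
    apply Equiv.ext
    intro x
    apply Subtype.ext
    change (act σ ε x : ℤ) = _
    rcases eq_zero_or_eq_signed x.2 with h0 | ⟨e, i, h0⟩
    · rw [act_zero _ _ h0, h0, apply_eq_zero π h0]
    · rw [act_signed _ _ h0, ← hodd]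
      congr 3
      exact h0.symm

/-- Signed permutations as pairs of a permutation and a vector of signs. -/
noncomputable def pairEquiv (n : ℕ) : Equiv.Perm (Fin n) × (Fin n → Bool) ≃ SignedPerm n :=
  Equiv.ofBijective ofPair (ofPair_bijective n)

theorem mem_DesSet_ofPair_zero {n : ℕ} (p : Equiv.Perm (Fin n) × (Fin n → Bool)) {i : Fin n}
    (hi : (i : ℕ) = 0) : i ∈ DesSet (ofPair p) ↔ p.2 i = false := by
  have : i.castSucc = 0 := Fin.ext (by simpa using hi)
  simp only [DesSet, Finset.mem_filter, Finset.mem_univ, true_and, entry_succ_ofPair, this,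
    entry_zero_ofPair]
  cases p.2 i <;> simp [signed, rLT] <;> omega

theorem mem_DesSet_ofPair_succ {n : ℕ} (p : Equiv.Perm (Fin n) × (Fin n → Bool)) {i j : Fin n}
    (hij : (j : ℕ) = i + 1) :
    j ∈ DesSet (ofPair p) ↔ toLex (p.2 j, p.1 j) < toLex (p.2 i, p.1 i) := by
  have : j.castSucc = i.succ := Fin.ext (by simpa using hij)
  simp only [DesSet, Finset.mem_filter, Finset.mem_univ, true_and, entry_succ_ofPair, this,
    rLT_signed]

/-! ### Sequences compatible with a signed permutation -/

/-- The sequences `f` that increase weakly along `p`, with strict increases at the descents. -/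
def Compat {n k : ℕ} (p : Equiv.Perm (Fin n) × (Fin n → Bool)) (f : Fin n → Fin (k + 1)) : Prop :=
  StrictMono (fun i => toLex (f i, toLex (p.2 i, p.1 i))) ∧ ∀ i, f i = 0 → p.2 i = true

/-- The lexicographic condition forces `f` to jump exactly where (sign, absolute value) drops, that
is, at a descent. Descent 0 means that the first sign is negative, which is where the condition on
zeros of `f` enters. -/
theorem compat_iff {n k : ℕ} (p : Equiv.Perm (Fin n) × (Fin n → Bool)) (f : Fin n → Fin (k + 1)) :
    Compat p f ↔ (∀ i : Fin n, (i : ℕ) = 0 → (if i ∈ DesSet (ofPair p) then 1 else 0) ≤ (f i : ℕ)) ∧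
      ∀ i j : Fin n, (j : ℕ) = i + 1 →
        (f i : ℕ) + (if j ∈ DesSet (ofPair p) then 1 else 0) ≤ f j := by
  have hstep : StrictMono (fun i => toLex (f i, toLex (p.2 i, p.1 i))) ↔
      ∀ i j : Fin n, (j : ℕ) = i + 1 →
        (f i : ℕ) + (if j ∈ DesSet (ofPair p) then 1 else 0) ≤ f j := by
    rw [strictMono_fin_iff]
    refine forall₃_congr fun i j hij => ?_
    have hne : toLex (p.2 i, p.1 i) ≠ toLex (p.2 j, p.1 j) := by
      intro h
      have h1 : i = j := p.1.injective (congrArg (fun x => (ofLex x).2) h)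
      rw [h1] at hij
      omega
    have hD := mem_DesSet_ofPair_succ p hij
    rw [Prod.Lex.toLex_lt_toLex]
    dsimp only
    rw [Fin.lt_def, Fin.ext_iff]
    split_ifs with hd
    · have := (hD.1 hd).asymm
      simp only [this, and_false, or_false]
      omega
    · have := lt_of_le_of_ne (not_lt.1 (mt hD.2 hd)) hne
      simp only [this, and_true]
      omega
  rw [Compat, hstep, and_comm]
  refine and_congr_left fun h => ⟨fun hz i hi => ?_, fun h0 i hi => ?_⟩
  · split_ifs with hd
    · rw [mem_DesSet_ofPair_zero p hi] at hd
      by_contra hlt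
      have := hz i (Fin.ext (by rw [Fin.val_zero]; omega))
      simp [hd] at this
    · omega
  -- If `f i = 0`, then `f` vanishes from the first index up to `i`. Signs increase weakly on that
  -- stretch, so a positive first sign makes the sign at `i` positive.
  · have hmono := hstep.2 h
    have hn : 0 < n := i.pos
    set z : Fin n := ⟨0, hn⟩
    have hz : f z ≤ f i := by
      rcases (Fin.le_def.2 (Nat.zero_le _) : z ≤ i).lt_or_eq with hlt | heq
      · rcases Prod.Lex.toLex_lt_toLex.1 (hmono hlt) with h1 | h1
        · exact h1.le
        · exact h1.1.le
      · rw [heq]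
    have hfz : f z = 0 := by rw [hi] at hz; exact Fin.le_zero_iff.1 hz
    have hez : p.2 z = true := by
      by_contra hc
      have := h0 z rfl
      rw [if_pos ((mem_DesSet_ofPair_zero p rfl).2 (Bool.eq_false_of_not_eq_true hc)), hfz] at this
      simp at this
    rcases (Fin.le_def.2 (Nat.zero_le _) : z ≤ i).lt_or_eq with hlt | heq
    · have h1 := hmono hlt
      simp only [hi, hfz, Prod.Lex.toLex_lt_toLex, lt_irrefl, true_and, false_or, hez] at h1
      rcases h1 with h1 | h1
      · exact absurd h1 (by simp)
      · exact h1.1.symm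
    · rw [← heq]; exact hez

theorem card_compat {n : ℕ} (k : ℕ) (p : Equiv.Perm (Fin n) × (Fin n → Bool)) :
    Nat.card {f : Fin n → Fin (k + 1) // Compat p f} = (k + n - des (ofPair p)).choose n := by
  simp only [compat_iff]
  rw [card_fin_gapSeqs]
  simp [des]


/-! ### The bijection with increasing sequences of cells -/

/-- Triples `(a, e, c)` with `a ≤ k`, `c ≤ l` and a sign `e`, which is positive when `a` or `c`
vanishes, ordered lexicographically. -/
abbrev Cell (k l : ℕ) : Type :=
  {x : Fin (k + 1) ×ₗ (Bool ×ₗ Fin (l + 1)) //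
    ((ofLex x).1 = 0 ∨ (ofLex (ofLex x).2).2 = 0) → (ofLex (ofLex x).2).1 = true}

/-- The nonnegative cells and the negative ones. -/
def cellEquiv (k l : ℕ) : Cell k l ≃ (Fin (k + 1) × Fin (l + 1)) ⊕ (Fin k × Fin l) where
  toFun x := if h : (ofLex (ofLex x.1).2).1 = true then
      Sum.inl ((ofLex x.1).1, (ofLex (ofLex x.1).2).2)
    else Sum.inr ((ofLex x.1).1.pred fun h0 => h (x.2 (Or.inl h0)),
      (ofLex (ofLex x.1).2).2.pred fun h0 => h (x.2 (Or.inr h0)))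
  invFun := Sum.elim (fun p => ⟨toLex (p.1, toLex (true, p.2)), fun _ => rfl⟩)
    (fun p => ⟨toLex (p.1.succ, toLex (false, p.2.succ)), fun h => by simp at h⟩)
  left_inv := by
    rintro ⟨⟨a, e, c⟩, h⟩
    cases e
    · apply Subtype.ext
      have ha : a ≠ 0 := fun h0 => Bool.false_ne_true (h (Or.inl h0))
      have hc : c ≠ 0 := fun h0 => Bool.false_ne_true (h (Or.inr h0))
      change toLex ((a.pred ha).succ, toLex (false, (c.pred hc).succ)) = _
      rw [Fin.succ_pred, Fin.succ_pred]
      rfl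
    · rfl
  right_inv := by
    rintro (⟨a, c⟩ | ⟨a, c⟩)
    · rfl
    · simp

theorem card_cell (k l : ℕ) : Fintype.card (Cell k l) = (2 * k * l + k + l) + 1 := by
  rw [Fintype.card_congr (cellEquiv k l)]
  simp
  ring

/-- Strict increase of (value, sign, index) along `σ⁻¹` says that `σ⁻¹` sorts by (value, sign) and
breaks ties by index: it is the stable sort. Hence `h` and `ε` determine `σ`. -/
theorem compat_inv_iff {n l : ℕ} (σ : Equiv.Perm (Fin n)) (ε : Fin n → Bool)
    (h : Fin n → Fin (l + 1)) :
    Compat (σ⁻¹, ε ∘ ⇑σ⁻¹) (h ∘ ⇑σ⁻¹) ↔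
      σ⁻¹ = Tuple.sort (fun i => toLex (h i, ε i)) ∧ ∀ i, h i = 0 → ε i = true := by
  refine and_congr ?_ ⟨fun H i => ?_, fun H i => H _⟩
  · rw [Tuple.eq_sort_iff]
    refine ⟨fun H => ⟨fun i j hij => ?_, fun i j hij heq => ?_⟩, fun H i j hij => ?_⟩
    · rcases hij.lt_or_eq with hlt | rfl
      · have := H hlt
        simp only [Prod.Lex.toLex_lt_toLex, Function.comp_apply, Prod.Lex.toLex_le_toLex] at this ⊢
        rcases this with h1 | ⟨h1, h2 | h2⟩
        · exact Or.inl h1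
        · exact Or.inr ⟨h1, h2.le⟩
        · exact Or.inr ⟨h1, h2.1.le⟩
      · exact le_rfl
    · have := H hij
      have h1 : h (σ⁻¹ i) = h (σ⁻¹ j) := congrArg (fun x => (ofLex x).1) heq
      have h2 : ε (σ⁻¹ i) = ε (σ⁻¹ j) := congrArg (fun x => (ofLex x).2) heq
      have h3 := ((Prod.Lex.toLex_lt_toLex.1 this).resolve_left h1.not_lt).2
      exact ((Prod.Lex.toLex_lt_toLex.1 h3).resolve_left h2.not_lt).2
    · have h1 := H.1 hij.le
      have h2 := H.2 i j hij
      simp only [Prod.Lex.toLex_lt_toLex, Function.comp_apply, Prod.Lex.toLex_le_toLex,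
        EmbeddingLike.apply_eq_iff_eq, Prod.mk.injEq] at h1 h2 ⊢
      rcases h1 with h1 | ⟨h1, h3⟩
      · exact Or.inl h1
      · refine Or.inr ⟨h1, ?_⟩
        rcases h3.lt_or_eq with h3 | h3
        · exact Or.inl h3
        · exact Or.inr ⟨h3, h2 ⟨h1, h3⟩⟩
  · have := H (σ i)
    simpa [show σ⁻¹ (σ i) = i from σ.symm_apply_apply i] using this

theorem compat_sort_iff {n k l : ℕ} {σ : Equiv.Perm (Fin n)} {ε : Fin n → Bool}
    {h : Fin n → Fin (l + 1)} (hσ : σ⁻¹ = Tuple.sort (fun i => toLex (h i, ε i)))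
    (f : Fin n → Fin (k + 1)) :
    StrictMono (fun i => toLex (f i, toLex (ε i, σ i))) ↔
      Monotone (fun i => toLex (f i, toLex (ε i, h i))) := by
  -- `σ i` is the rank of `i` in the stable sort. For equal signs the rank compares `h` alone, and a
  -- tie goes to the smaller index `i`; so `<` on ranks becomes `≤` on `h`.
  have hs : ∀ i j, i < j → ε i = ε j → (σ i < σ j ↔ h i ≤ h j) := by
    intro i j hij he
    obtain ⟨h1, h2⟩ := Tuple.eq_sort_iff.1 hσ
    have hinv : ∀ x, σ⁻¹ (σ x) = x := σ.symm_apply_apply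
    constructor
    · intro hlt
      have := h1 hlt.le
      simp only [Function.comp_apply, hinv, Prod.Lex.toLex_le_toLex] at this
      rcases this with h3 | h3
      · exact h3.le
      · exact h3.1.le
    · intro hle
      by_contra hlt
      rcases (not_lt.1 hlt).lt_or_eq with h3 | h3
      · have h4 := h1 h3.le
        have h5 := h2 _ _ h3
        simp only [Function.comp_apply, hinv, Prod.Lex.toLex_le_toLex] at h4 h5
        rcases h4 with h4 | h4
        · exact absurd h4 (not_lt.2 hle)
        · exact absurd (h5 (by rw [h4.1, he])) hij.asymm
      · exact hij.ne' (σ.injective h3)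
  have key : ∀ i j, i < j → (toLex (f i, toLex (ε i, σ i)) < toLex (f j, toLex (ε j, σ j)) ↔
      toLex (f i, toLex (ε i, h i)) ≤ toLex (f j, toLex (ε j, h j))) := by
    intro i j hij
    simp only [Prod.Lex.toLex_lt_toLex, Prod.Lex.toLex_le_toLex]
    refine or_congr_right (and_congr_right fun _ => or_congr_right (and_congr_right fun he => ?_))
    exact hs i j hij he
  refine ⟨fun H i j hij => ?_, fun H i j hij => (key i j hij).2 (H hij.le)⟩
  rcases hij.lt_or_eq with hlt | rfl
  · exact (key i j hlt).1 (H hlt)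
  · exact le_rfl

theorem compatSigma_ext {n k l : ℕ}
    {t t' : Σ p : Equiv.Perm (Fin n) × (Fin n → Bool),
      {f : Fin n → Fin (k + 1) // Compat p f} ×
      {g : Fin n → Fin (l + 1) // Compat (p.1⁻¹, p.2 ∘ ⇑p.1⁻¹) g}}
    (h1 : t.1.1 = t'.1.1) (h2 : t.1.2 = t'.1.2) (h3 : t.2.1.1 = t'.2.1.1)
    (h4 : t.2.2.1 = t'.2.2.1) : t = t' := by
  obtain ⟨⟨σ, ε⟩, ⟨f, hf⟩, ⟨g, hg⟩⟩ := t
  obtain ⟨⟨σ', ε'⟩, ⟨f', hf'⟩, ⟨g', hg'⟩⟩ := t'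
  dsimp only at h1 h2 h3 h4
  subst h1 h2 h3 h4
  rfl

/-- A permutation together with compatible sequences for it and for its inverse amounts to a weakly
increasing sequence of cells. -/
def compatEquiv (n k l : ℕ) :
    (Σ p : Equiv.Perm (Fin n) × (Fin n → Bool),
      {f : Fin n → Fin (k + 1) // Compat p f} ×
      {g : Fin n → Fin (l + 1) // Compat (p.1⁻¹, p.2 ∘ ⇑p.1⁻¹) g}) ≃
    {c : Fin n → Cell k l // Monotone c} where
  toFun t :=
    have H := (compat_inv_iff t.1.1 t.1.2 (t.2.2.1 ∘ ⇑t.1.1)).1 (by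
      rw [Function.comp_assoc, ← Equiv.Perm.coe_mul, mul_inv_cancel, Equiv.Perm.coe_one,
        Function.comp_id]
      exact t.2.2.2)
    ⟨fun i => ⟨toLex (t.2.1.1 i, toLex (t.1.2 i, t.2.2.1 (t.1.1 i))),
      fun h => h.elim (t.2.1.2.2 i) (H.2 i)⟩,
      (compat_sort_iff H.1 t.2.1.1).1 t.2.1.2.1⟩
  invFun c :=
    let f : Fin n → Fin (k + 1) := fun i => (ofLex (c.1 i).1).1
    let ε : Fin n → Bool := fun i => (ofLex (ofLex (c.1 i).1).2).1
    let h : Fin n → Fin (l + 1) := fun i => (ofLex (ofLex (c.1 i).1).2).2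
    let σ := (Tuple.sort (fun i => toLex (h i, ε i)))⁻¹
    ⟨(σ, ε), ⟨f, (compat_sort_iff (σ := σ) (ε := ε) (inv_inv _) f).2 c.2,
        fun i hi => (c.1 i).2 (Or.inl hi)⟩,
      ⟨h ∘ ⇑σ⁻¹, (compat_inv_iff σ ε h).2 ⟨inv_inv _, fun i hi => (c.1 i).2 (Or.inr hi)⟩⟩⟩
  left_inv := by
    rintro ⟨⟨σ, ε⟩, ⟨f, hf⟩, ⟨g, hg⟩⟩
    have hgσ : (g ∘ ⇑σ) ∘ ⇑σ⁻¹ = g := by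
      rw [Function.comp_assoc, ← Equiv.Perm.coe_mul, mul_inv_cancel, Equiv.Perm.coe_one,
        Function.comp_id]
    have H := (compat_inv_iff σ ε (g ∘ ⇑σ)).1 (by rw [hgσ]; exact hg)
    have H1 : (Tuple.sort (fun i => toLex (g (σ i), ε i)))⁻¹ = σ :=
      inv_eq_iff_eq_inv.2 H.1.symm
    have H2 : ∀ i, σ ((Tuple.sort (fun i => toLex (g (σ i), ε i)))⁻¹⁻¹ i) = i := by
      intro i
      rw [H1]
      exact σ.apply_symm_apply i
    exact compatSigma_ext H1 rfl rfl (funext fun i => congrArg g (H2 i))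
  right_inv := by
    rintro ⟨c, hc⟩
    apply Subtype.ext
    funext i
    apply Subtype.ext
    simp

theorem sum_signedPerm (n k l : ℕ) :
    ∑ᶠ π : SignedPerm n, (k + n - des π).choose n * (l + n - ides π).choose n =
      (2 * k * l + k + l + n).choose n := by
  rw [← card_monotone n _ (card_cell k l), ← Nat.card_congr (compatEquiv n k l), Nat.card_sigma,
    ← finsum_eq_sum_of_fintype, ← finsum_comp_equiv (pairEquiv n)]
  refine finsum_congr fun p => ?_
  rw [Nat.card_prod, card_compat, card_compat, ← inv_ofPair]
  rfl


/-! ### From the two-variable identity to the recurrence -/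

theorem des_le {n : ℕ} (π : SignedPerm n) : des π ≤ n :=
  (Finset.card_le_univ _).trans_eq (Fintype.card_fin n)

theorem ides_le {n : ℕ} (π : SignedPerm n) : ides π ≤ n :=
  (Finset.card_le_univ _).trans_eq (Fintype.card_fin n)

theorem b_eq_zero {n : ℕ} {i j : ℤ} (h : i < 0 ∨ j < 0 ∨ (n : ℤ) < i ∨ (n : ℤ) < j) :
    b n i j = 0 := by
  have : B n i j = ∅ := by
    ext π
    have := des_le π
    have := ides_le π
    simp only [B, Set.mem_ofPred_eq, Set.mem_empty_iff_false, iff_false]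
    omega
  rw [b, this, Set.ncard_empty]

theorem sum_b (n k l : ℕ) :
    ∑ i ∈ Finset.range (n + 1), ∑ j ∈ Finset.range (n + 1),
      b n i j * ((k + n - i).choose n * (l + n - j).choose n) =
      (2 * k * l + k + l + n).choose n := by
  classical
  have : Fintype (SignedPerm n) := Fintype.ofFinite _
  rw [← sum_signedPerm, finsum_eq_sum_of_fintype, ← Finset.sum_product',
    ← Finset.sum_fiberwise_of_maps_to (s := Finset.univ) (g := fun π => (des π, ides π))
      (t := Finset.range (n + 1) ×ˢ Finset.range (n + 1))
      fun π _ => by simp [des_le, ides_le]]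
  refine Finset.sum_congr rfl fun p _ => ?_
  have hb : b n p.1 p.2 = (Finset.univ.filter fun π : SignedPerm n => (des π, ides π) = p).card := by
    rw [b, ← Set.ncard_coe_finset]
    congr 1
    ext π
    simp [B, Prod.ext_iff]
  rw [hb, ← smul_eq_mul, ← Finset.sum_const]
  refine Finset.sum_congr rfl fun π hπ => ?_
  rw [← (Finset.mem_filter.1 hπ).2]

theorem eq_zero_of_sum_choose_eq_zero {n : ℕ} {u : ℕ → ℤ}
    (h : ∀ k : ℕ, ∑ i ∈ Finset.range (n + 1), u i * ((k + n - i).choose n : ℕ) = 0) (i : ℕ)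
    (hi : i ≤ n) : u i = 0 := by
  induction i using Nat.strong_induction_on with
  | _ i ih =>
    -- At `k = i` the system is triangular: terms of index above `i` have a zero binomial, those
    -- below vanish by induction, and the diagonal binomial is 1.
    have h1 := h i
    rw [Finset.sum_eq_single i] at h1
    · simpa using h1
    · intro j hj hne
      have := Finset.mem_range.1 hj
      rcases hne.lt_or_gt with hlt | hgt
      · rw [ih j hlt (by omega), zero_mul]
      · rw [Nat.choose_eq_zero_of_lt (by omega), Nat.cast_zero, mul_zero]
    · intro hn
      exact absurd (Finset.mem_range.2 (by omega)) hn

theorem eq_zero_of_sum_sum_choose_eq_zero {n : ℕ} {w : ℕ → ℕ → ℤ}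
    (h : ∀ k l : ℕ, ∑ i ∈ Finset.range (n + 1), ∑ j ∈ Finset.range (n + 1),
      w i j * (((k + n - i).choose n : ℕ) * ((l + n - j).choose n : ℕ)) = 0) (i j : ℕ)
    (hi : i ≤ n) (hj : j ≤ n) : w i j = 0 := by
  refine eq_zero_of_sum_choose_eq_zero (u := w i) (fun l => ?_) j hj
  refine eq_zero_of_sum_choose_eq_zero
    (u := fun i => ∑ j ∈ Finset.range (n + 1), w i j * ((l + n - j).choose n : ℕ))
    (fun k => ?_) i hi
  rw [← h k l]
  refine Finset.sum_congr rfl fun i _ => ?_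
  rw [Finset.sum_mul]
  exact Finset.sum_congr rfl fun j _ => by ring

theorem succ_mul_choose_shift {m k i : ℕ} (hi : i ≤ m) :
    ((m : ℤ) + 1) * ((k + (m + 1) - i).choose (m + 1) : ℕ) =
      (k + m + 1 - i) * ((k + m - i).choose m : ℕ) := by
  have h := Nat.add_one_mul_choose_eq (k + m - i) m
  rw [show k + (m + 1) - i = k + m - i + 1 by omega]
  zify [show i ≤ k + m by omega] at h
  linarith

/-- The integer factor `k - i` may be negative, but then both binomials are zero. -/
theorem succ_mul_choose_shift_succ {m k i : ℕ} (hi : i ≤ m) :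
    ((m : ℤ) + 1) * ((k + (m + 1) - (i + 1)).choose (m + 1) : ℕ) =
      (k - i) * ((k + m - i).choose m : ℕ) := by
  have h := Nat.choose_succ_right_eq (k + m - i) m
  rw [show k + (m + 1) - (i + 1) = k + m - i by omega]
  rcases le_or_gt i k with hk | hk
  · rw [show k + m - i - m = k - i by omega] at h
    zify [hk] at h
    linarith
  · rw [Nat.choose_eq_zero_of_lt (by omega : k + m - i < m),
      Nat.choose_eq_zero_of_lt (by omega : k + m - i < m + 1)]
    simp

/-- The right-hand side of the recurrence for the two-sided Eulerian numbers of length `n`. -/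
def recRHS (n : ℤ) (c : ℤ → ℤ → ℤ) (i j : ℤ) : ℤ :=
  (n + i + j + 2 * i * j) * c i j
    + ((2 * n - 1) * i - (2 * i + 1) * (j - 1)) * c i (j - 1)
    + ((2 * n - 1) * j - (2 * j + 1) * (i - 1)) * c (i - 1) j
    + ((2 * n ^ 2 - n) + 2 * (i - 1) * (j - 1) + (1 - 2 * n) * (i + j - 2)) * c (i - 1) (j - 1)

theorem sum_range_shift (m : ℕ) (G H : ℕ → ℤ) (c : ℤ → ℤ) (hneg : c (-1) = 0)
    (hm : c (m + 1) = 0) :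
    ∑ i ∈ Finset.range (m + 2), (G i * c i + H i * c (i - 1)) =
      ∑ i ∈ Finset.range (m + 1), (G i + H (i + 1)) * c i := by
  rw [Finset.sum_add_distrib, Finset.sum_range_succ, Finset.sum_range_succ' (fun i => H i * _)]
  push_cast
  rw [hm, hneg]
  simp only [add_sub_cancel_right, mul_zero, add_zero, add_mul, Finset.sum_add_distrib]

/-- After shifting indices, each `c i j` collects four products of binomials of order `m + 1`. Each
is a polynomial multiple of the same product of order `m`, and the four multiples add up to `2kl + k
+ l + m + 1`, independently of `i` and `j`. -/
theorem sum_recRHS (m k l : ℕ) (c : ℤ → ℤ → ℤ)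
    (hc : ∀ i j, (i < 0 ∨ j < 0 ∨ (m : ℤ) < i ∨ (m : ℤ) < j) → c i j = 0) :
    ∑ i ∈ Finset.range (m + 2), ∑ j ∈ Finset.range (m + 2), recRHS (m + 1) c i j *
        (((k + (m + 1) - i).choose (m + 1) : ℕ) * ((l + (m + 1) - j).choose (m + 1) : ℕ)) =
      (2 * k * l + k + l + m + 1) * ∑ i ∈ Finset.range (m + 1), ∑ j ∈ Finset.range (m + 1),
        c i j * (((k + m - i).choose m : ℕ) * ((l + m - j).choose m : ℕ)) := by
  set P : ℕ → ℤ := fun i => ((k + (m + 1) - i).choose (m + 1) : ℕ)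
  set Q : ℕ → ℤ := fun j => ((l + (m + 1) - j).choose (m + 1) : ℕ)
  set n : ℤ := m + 1 with hn
  let c00 : ℤ → ℤ → ℤ := fun i j => n + i + j + 2 * i * j
  let c01 : ℤ → ℤ → ℤ := fun i j => (2 * n - 1) * i - (2 * i + 1) * (j - 1)
  let c10 : ℤ → ℤ → ℤ := fun i j => (2 * n - 1) * j - (2 * j + 1) * (i - 1)
  let c11 : ℤ → ℤ → ℤ := fun i j =>
    (2 * n ^ 2 - n) + 2 * (i - 1) * (j - 1) + (1 - 2 * n) * (i + j - 2)
  have h1 : ∀ i : ℕ, ∑ j ∈ Finset.range (m + 2), recRHS n c i j * (P i * Q j) =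
      (∑ j ∈ Finset.range (m + 1), (c00 i j * P i * Q j + c01 i (j + 1) * P i * Q (j + 1)) * c i j)
      + ∑ j ∈ Finset.range (m + 1),
        (c10 i j * P i * Q j + c11 i (j + 1) * P i * Q (j + 1)) * c (i - 1) j := by
    intro i
    have e1 := sum_range_shift m (fun j => c00 i j * P i * Q j) (fun j => c01 i j * P i * Q j)
      (c i) (hc _ _ (by omega)) (hc _ _ (by omega))
    have e2 := sum_range_shift m (fun j => c10 i j * P i * Q j) (fun j => c11 i j * P i * Q j)
      (c (i - 1)) (hc _ _ (by omega)) (hc _ _ (by omega))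
    push_cast at e1 e2
    rw [← e1, ← e2, ← Finset.sum_add_distrib]
    refine Finset.sum_congr rfl fun j _ => ?_
    simp only [recRHS, c00, c01, c10, c11]
    ring
  have h2 : ∑ i ∈ Finset.range (m + 2), ∑ j ∈ Finset.range (m + 2), recRHS n c i j * (P i * Q j) =
      ∑ j ∈ Finset.range (m + 1), ∑ i ∈ Finset.range (m + 1),
        ((c00 i j * P i * Q j + c01 i (j + 1) * P i * Q (j + 1)) +
          (c10 (i + 1) j * P (i + 1) * Q j + c11 (i + 1) (j + 1) * P (i + 1) * Q (j + 1)))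
          * c i j := by
    simp only [h1]
    rw [Finset.sum_add_distrib, Finset.sum_comm,
      Finset.sum_comm (t := Finset.range (m + 1)), ← Finset.sum_add_distrib]
    refine Finset.sum_congr rfl fun j _ => ?_
    have e := sum_range_shift m (fun i => c00 i j * P i * Q j + c01 i (j + 1) * P i * Q (j + 1))
      (fun i => c10 i j * P i * Q j + c11 i (j + 1) * P i * Q (j + 1)) (fun i => c i j)
      (hc _ _ (by omega)) (hc _ _ (by omega))
    push_cast at e
    rw [← e, ← Finset.sum_add_distrib]
  rw [h2, Finset.sum_comm, Finset.mul_sum]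
  refine Finset.sum_congr rfl fun i hi => ?_
  rw [Finset.mul_sum]
  refine Finset.sum_congr rfl fun j hj => ?_
  have hi' : i ≤ m := by have := Finset.mem_range.1 hi; omega
  have hj' : j ≤ m := by have := Finset.mem_range.1 hj; omega
  have p0 : n * P i = _ := succ_mul_choose_shift (k := k) hi'
  have p1 : n * P (i + 1) = _ := succ_mul_choose_shift_succ (k := k) hi'
  have q0 : n * Q j = _ := succ_mul_choose_shift (k := l) hj'
  have q1 : n * Q (j + 1) = _ := succ_mul_choose_shift_succ (k := l) hj'
  -- One factor `n` for each of the two binomials, to clear denominators in the shift formulas.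
  have hn0 : n ^ 2 ≠ 0 := pow_ne_zero 2 (by omega)
  apply mul_left_cancel₀ hn0
  generalize ((k + m - i).choose m : ℕ) = X at *
  generalize ((l + m - j).choose m : ℕ) = Y at *
  have expand : n ^ 2 * (((c00 i j * P i * Q j + c01 i (j + 1) * P i * Q (j + 1)) +
      (c10 (i + 1) j * P (i + 1) * Q j + c11 (i + 1) (j + 1) * P (i + 1) * Q (j + 1))) * c i j) =
      (c00 i j * ((n * P i) * (n * Q j)) + c01 i (j + 1) * ((n * P i) * (n * Q (j + 1))) +
      c10 (i + 1) j * ((n * P (i + 1)) * (n * Q j)) +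
      c11 (i + 1) (j + 1) * ((n * P (i + 1)) * (n * Q (j + 1)))) * c i j := by ring
  rw [expand, p0, p1, q0, q1]
  simp only [c00, c01, c10, c11, hn]
  ring

/-- Both sides have the same sums against the products of binomials for all `k` and `l`, hence agree
termwise. -/
theorem succ_mul_b_succ (m i j : ℕ) (hi : i ≤ m + 1) (hj : j ≤ m + 1) :
    ((m : ℤ) + 1) * b (m + 1) i j = recRHS (m + 1) (fun i j => b m i j) i j := by
  rw [← sub_eq_zero]
  refine eq_zero_of_sum_sum_choose_eq_zero
    (w := fun i j => ((m : ℤ) + 1) * b (m + 1) i j - recRHS (m + 1) (fun i j => b m i j) i j)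
    (fun k l => ?_) i j hi hj
  simp only [sub_mul, Finset.sum_sub_distrib]
  rw [sum_recRHS m k l _ fun i j h => by rw [b_eq_zero h, Nat.cast_zero]]
  have h1 := sum_b (m + 1) k l
  have h2 := sum_b m k l
  have h3 := Nat.add_one_mul_choose_eq (2 * k * l + k + l + m) m
  rw [← h2, show 2 * k * l + k + l + m + 1 = 2 * k * l + k + l + (m + 1) by ring, ← h1] at h3
  zify at h3
  simp only [mul_assoc, ← Finset.mul_sum] at h3 ⊢
  linarith

theorem b_one : b 1 0 0 = 1 ∧ b 1 1 1 = 1 ∧ b 1 0 1 = 0 ∧ b 1 1 0 = 0 := by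
  -- The identity at `k, l ∈ {0, 1}` is a triangular linear system for the four numbers.
  have h00 := sum_b 1 0 0
  have h10 := sum_b 1 1 0
  have h01 := sum_b 1 0 1
  have h11 := sum_b 1 1 1
  simp [Finset.sum_range_succ] at h00 h10 h01 h11
  omega

end TypeB

theorem mainTheorem2 :
    (∀ (n : ℕ) (i j : ℤ), 2 ≤ n → 0 ≤ i → i ≤ n → 0 ≤ j → j ≤ n →
      (n : ℤ) * (TypeB.b n i j : ℤ) =
        ((n : ℤ) + i + j + 2 * i * j) * (TypeB.b (n - 1) i j : ℤ)
        + ((2 * (n : ℤ) - 1) * i - (2 * i + 1) * (j - 1)) * (TypeB.b (n - 1) i (j - 1) : ℤ)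
        + ((2 * (n : ℤ) - 1) * j - (2 * j + 1) * (i - 1)) * (TypeB.b (n - 1) (i - 1) j : ℤ)
        + ((2 * (n : ℤ) ^ 2 - n) + 2 * (i - 1) * (j - 1) + (1 - 2 * (n : ℤ)) * (i + j - 2))
          * (TypeB.b (n - 1) (i - 1) (j - 1) : ℤ)) ∧
    TypeB.b 1 0 0 = 1 ∧ TypeB.b 1 1 1 = 1 ∧ TypeB.b 1 0 1 = 0 ∧ TypeB.b 1 1 0 = 0 ∧
    (∀ (n : ℕ) (i j : ℤ), 1 ≤ n → (i < 0 ∨ j < 0) → TypeB.b n i j = 0) := by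
  obtain ⟨h1, h2, h3, h4⟩ := TypeB.b_one
  refine ⟨fun n i j hn hi0 hi hj0 hj => ?_, h1, h2, h3, h4, fun n i j _ h =>
    TypeB.b_eq_zero (h.elim Or.inl fun h => Or.inr (Or.inl h))⟩
  obtain ⟨m, rfl⟩ : ∃ m, n = m + 1 := ⟨n - 1, by omega⟩
  lift i to ℕ using hi0
  lift j to ℕ using hj0
  have h := TypeB.succ_mul_b_succ m i j (by exact_mod_cast hi) (by exact_mod_cast hj)
  rw [Nat.add_sub_cancel]
  push_cast
  exact h
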